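/- Let $p,K\ge 0$ be integers and let $\mathcal I=(I_0,I_1,\dots,I_K)$ be a sequence of (known) intervention targets $I_k\subseteq[p]$ with $I_0=\emptyset$. **Graphs and polytope.** For a DAG $\mathcal D$ on a finite node set $V$ write $\mathrm{pa}_{\mathcal D}(v)$ for the set of parents of $v$ and $\mathrm{fa}_{\mathcal D}(v)=\{v\}\cup\mathrm{pa}_{\mathcal D}(v)$. Its standard imset is $u_{\mathcal D}=\delta_V-\delta_\emptyset+\sum_{v\in V}(\delta_{\mathrm{pa}_{\mathcal D}(v)}-\delta_{\mathrm{fa}_{\mathcal D}(v)})\in\mathbb R^{2^V}$ and its characteristic imset is $c_{\mathcal D}(S)=1-\sum_{T\supseteq S}u_{\mathcal D}(T)$, $S\subseteq V$. For a DAG $\mathcal G=([p],E)$, the $\mathcal I$-DAG $\mathcal G^{\mathcal I}$ has nodes $[p]\sqcup\mathcal Z_{\mathcal I}$, $\mathcal Z_{\mathcal I}=\{z_1,\dots,z_K\}$, and edges $E\cup\bigcup_{k=1}^K\{z_k\to i: i\in I_k\}$. Put $\mathrm{CIM}_p^{\mathcal I}=\mathrm{conv}\{c_{\mathcal G^{\mathcal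 I}}:\mathcal G\text{ a DAG on }[p]\}$. **Model and BIC.** The Gaussian $\mathcal I$-DAG model of $\mathcal G$ has parameters $\theta=((\Lambda^{(k)},\omega^{(k)}))_{k=0}^K$ with $\lambda^{(k)}_{ij}=0$ unless $j\to i\in E$, $\omega_i^{(k)}>0$, and $\lambda^{(k)}_{ij}=\lambda^{(0)}_{ij}$, $\omega^{(k)}_i=\omega^{(0)}_i$ for $i\notin I_k$; in experiment $k$ the observations are independent with law $N(0,\Sigma^{(k)})$, $\Sigma^{(k)}=(\mathrm I-\Lambda^{(k)})^{-1}\mathrm{diag}(\omega^{(k)})(\mathrm I-\Lambda^{(k)})^{-T}$, i.e. the law of the solution of $X=\Lambda^{(k)}X+\varepsilon$ with independent $\varepsilon_i\sim N(0,\omega_i^{(k)})$. For data $\mathbb D=(x^k_{:,j}\in\mathbb R^p:0\le k\le K,\ 1\le j\le n_k)$ let $n=\sum_k n_k$, let $L(\theta\mid\mathbb D)$ be the likelihood, and $$\mathrm{BIC}(\mathcal G,\mathcal I;\mathbb D)=\log L(\hat\theta\mid\mathbb D)-\frac{\log n}{2}\Big(p+|E|+\sum_{k=1}^K\big(|I_k|+\sum_{i\in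 I_k}|\mathrm{pa}_{\mathcal G}(i)|\big)\Big),$$ where $\hat\theta$ is the MLE (the unique maximizer of $L$ over the parameters of the model of $\mathcal G$) and the bracket is the number of free parameters. Assume that $\mathbb D$ is such that this MLE exists for every DAG $\mathcal G$ on $[p]$. Call $\mathcal G$ (and $\mathcal G^{\mathcal I}$) BIC-optimal if $\mathrm{BIC}(\mathcal G,\mathcal I;\mathbb D)\ge\mathrm{BIC}(\mathcal H,\mathcal I;\mathbb D)$ for every DAG $\mathcal H$ on $[p]$. **Data vector.** For $R\subseteq\{0,\dots,K\}$ let $S^{R}=\big(\sum_{k\in R}n_k\big)^{-1}\sum_{k\in R}\sum_{j}x^k_{:,j}(x^k_{:,j})^T$, and let $S_A^R$ be its submatrix with rows and columns in $A\subseteq[p]$. For $A\subseteq[p]$, $\mathcal Z\subseteq\mathcal Z_{\mathcal I}$, $Z=\{k:z_k\in\mathcal Z\}$ and $Z^c=\{0,\dots,K\}\setminus Z$ let $$\alpha_{A\sqcup\mathcal Z}=-\sum_{k\in Z^c}q_k(A,S^{Z^c})-\sum_{k\in Z}q_k(A,S^{\{k\}})-\frac{\log n}{2}(1+|Z|)\binom{|A|}{2},$$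 $$q_k(A,S)=\frac12\sum_{j=1}^{n_k}(x^k_{A,j})^TS_A^{-1}x^k_{A,j}+\frac{n_k}{2}\log\det S_A ,$$ where $x^k_{A,j}$ is the subvector of $x^k_{:,j}$ with entries in $A$. (In coordinates in which a singular matrix, or an average over no data, occurs, read $S^R=0$ for an average over no data, $S_A^{-1}=0$ for a singular matrix, and $\log t=\log|t|$ for $t<0$, $\log 0=0$.) Let $\beta$ be the Möbius transform of $\alpha$, $$\beta_A=\sum_{B\subseteq A}(-1)^{|A|-|B|}\alpha_B,\qquad A\subseteq[p]\sqcup\mathcal Z_{\mathcal I}.$$ **Theorem.** Consider the linear program: maximize $\beta\cdot x$ subject to $x\in\mathrm{CIM}_p^{\mathcal I}$. 1. It has an optimal solution of the form $c_{\mathcal G^{\mathcal I}}$ with $\mathcal G$ a DAG on $[p]$. 2. For every DAG $\mathcal G$ on $[p]$, $c_{\mathcal G^{\mathcal I}}$ is an optimal solution if and only if $\mathcal G$ is BIC-optimal. 3. Every optimal solution that is a vertex of $\mathrm{CIM}_p^{\mathcal I}$ equals $c_{\mathcal G^{\mathcal I}}$ for some BIC-optimal $\mathcal G$. 4. The set of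 all optimal solutions is $\mathrm{conv}\{c_{\mathcal G^{\mathcal I}}:\mathcal G\text{ BIC-optimal}\}$. -/

import Mathlib

open scoped Classical BigOperators

/-! ## Directed acyclic graphs and their imsets -/

/-- A directed acyclic graph (DAG) on the vertex set `V`; `Adj j i` means `j → i`. -/
structure DAG (V : Type) extends Digraph V where
  acyclic : ∀ v, ¬ Relation.TransGen Adj v v

namespace DAG

variable {V : Type} [Fintype V]

/-- The set of parents of `i`. -/
noncomputable def pa (G : DAG V) (i : V) : Finset V :=
  Finset.univ.filter fun j => G.Adj j i

/-- The family of `i`. -/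
noncomputable def fa (G : DAG V) (i : V) : Finset V :=
  insert i (G.pa i)

/-- The number of edges. -/
noncomputable def numEdges (G : DAG V) : ℕ :=
  (Finset.univ.filter fun e : V × V => G.Adj e.1 e.2).card

/-- The identifier function `δ_A` of a subset `A`. -/
noncomputable def delta (A : Finset V) : Finset V → ℝ :=
  fun B => if B = A then 1 else 0

/-- The standard imset `u_G`, as a vector indexed by the subsets of `V`. -/
noncomputable def standardImset (G : DAG V) : Finset V → ℝ :=
  delta Finset.univ - delta ∅ + ∑ i : V, (delta (G.pa i) - delta (G.fa i))

/-- The characteristic imset `c_G(S) = 1 - ∑_{S ⊆ T} u_G(T)`. -/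
noncomputable def charImset (G : DAG V) : Finset V → ℝ :=
  fun S => 1 - ∑ T ∈ Finset.univ.filter (fun T => S ⊆ T), G.standardImset T

end DAG

/-! ## `I`-DAGs and the interventional CIM polytope

A sequence of intervention targets `(I_0, …, I_K)` is a function `I : Fin (K + 1) → Finset (Fin p)`.
The node `z_k`, for `1 ≤ k ≤ K`, is represented by `Sum.inr (k - 1) : Fin p ⊕ Fin K`. -/

/-- The edges of the `I`-DAG: those of `G`, together with `z_k → i` for every `i ∈ I_k`. -/
def iDAGAdj {p K : ℕ} (G : DAG (Fin p)) (I : Fin (K + 1) → Finset (Fin p)) :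
    Fin p ⊕ Fin K → Fin p ⊕ Fin K → Prop
  | Sum.inl j, Sum.inl i => G.Adj j i
  | Sum.inr k, Sum.inl i => i ∈ I k.succ
  | _, Sum.inr _ => False

theorem iDAGAdj_transGen {p K : ℕ} (G : DAG (Fin p)) (I : Fin (K + 1) → Finset (Fin p))
    (a : Fin p) (w : Fin p ⊕ Fin K) (h : Relation.TransGen (iDAGAdj G I) (Sum.inl a) w) :
    ∃ b, w = Sum.inl b ∧ Relation.TransGen G.Adj a b := by
  induction h with
  | @single w h =>
    cases w with
    | inl b => exact ⟨b, rfl, Relation.TransGen.single h⟩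
    | inr k => exact absurd h (by simp [iDAGAdj])
  | @tail v w _ h ih =>
    obtain ⟨b, rfl, hb⟩ := ih
    cases w with
    | inl c => exact ⟨c, rfl, hb.tail h⟩
    | inr k => exact absurd h (by simp [iDAGAdj])

/-- The `I`-DAG `G^I` associated to the DAG `G` and the intervention targets `I`. -/
def iDAG {p K : ℕ} (G : DAG (Fin p)) (I : Fin (K + 1) → Finset (Fin p)) :
    DAG (Fin p ⊕ Fin K) where
  Adj := iDAGAdj G I
  acyclic := by
    rintro (a | k) h
    · obtain ⟨b, hb, h'⟩ := iDAGAdj_transGen G I a _ h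
      cases hb
      exact G.acyclic a h'
    · obtain ⟨v, -, h'⟩ := Relation.TransGen.tail'_iff.mp h
      cases v <;> exact h'

/-- The interventional CIM polytope: the convex hull of the characteristic imsets of the `I`-DAGs
`G^I`, where `G` runs over all DAGs on the node set. -/
noncomputable def CIM {p K : ℕ} (I : Fin (K + 1) → Finset (Fin p)) :
    Set (Finset (Fin p ⊕ Fin K) → ℝ) :=
  convexHull ℝ (Set.range fun G : DAG (Fin p) => (iDAG G I).charImset)

/-! ## Gaussian `I`-DAG models, their likelihood and the BIC -/

/-- Candidate parameters `((Λ^(k), ω^(k)) : 0 ≤ k ≤ K)`: edge coefficients and error variances. -/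
abbrev GaussParams (p K : ℕ) : Type :=
  Fin (K + 1) → Matrix (Fin p) (Fin p) ℝ × (Fin p → ℝ)

/-- The parameter space of the Gaussian `I`-DAG model of `G` and `I`: `λ^(k)_{ij} = 0` unless
`j → i` is an edge, the variances `ω^(k)_i` are positive, and the parameters of a node `i ∉ I_k`
agree with its observational ones. -/
def paramSpace {p K : ℕ} (G : DAG (Fin p)) (I : Fin (K + 1) → Finset (Fin p)) :
    Set (GaussParams p K) :=
  {θ | (∀ k i j, ¬ G.Adj j i → (θ k).1 i j = 0) ∧
       (∀ k i, 0 < (θ k).2 i) ∧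
       (∀ k i, i ∉ I k → (∀ j, (θ k).1 i j = (θ 0).1 i j) ∧ (θ k).2 i = (θ 0).2 i)}

/-- The covariance matrix of the solution `X` of `X = Λ X + ε`, where the `ε_i` are independent
with mean zero and variances `ω_i`. -/
noncomputable def gaussCov {p : ℕ} (Λ : Matrix (Fin p) (Fin p) ℝ) (ω : Fin p → ℝ) :
    Matrix (Fin p) (Fin p) ℝ :=
  (1 - Λ)⁻¹ * Matrix.diagonal ω * ((1 - Λ)⁻¹).transpose

/-- The density at `v` of the normal distribution with mean zero and covariance matrix `M`. -/
noncomputable def gaussDensity {p : ℕ} (M : Matrix (Fin p) (Fin p) ℝ) (v : Fin p → ℝ) : ℝ :=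
  (Real.sqrt ((2 * Real.pi) ^ p * M.det))⁻¹ * Real.exp (-(v ⬝ᵥ M⁻¹.mulVec v) / 2)

/-- Data from `K + 1` experiments: `x k j` is the `j`-th of the `n k` observations in the
experiment with target `I_k`. -/
abbrev Dataset (p K : ℕ) (n : Fin (K + 1) → ℕ) : Type :=
  (k : Fin (K + 1)) → Fin (n k) → Fin p → ℝ

/-- The likelihood of the parameters `θ` for the data `x`. -/
noncomputable def likelihood {p K : ℕ} {n : Fin (K + 1) → ℕ} (x : Dataset p K n)
    (θ : GaussParams p K) : ℝ :=
  ∏ k, ∏ j, gaussDensity (gaussCov (θ k).1 (θ k).2) (x k j)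

/-- `θ` is the maximum likelihood estimate, that is, the unique maximizer of the likelihood over
the parameter space of the Gaussian `I`-DAG model of `G` and `I`. -/
def IsMLE {p K : ℕ} {n : Fin (K + 1) → ℕ} (I : Fin (K + 1) → Finset (Fin p)) (x : Dataset p K n)
    (G : DAG (Fin p)) (θ : GaussParams p K) : Prop :=
  θ ∈ paramSpace G I ∧ ∀ θ' ∈ paramSpace G I, θ' ≠ θ → likelihood x θ' < likelihood x θ

/-- The number of free parameters of the Gaussian `I`-DAG model of `G` and `I`. -/
noncomputable def numFreeParams {p K : ℕ} (G : DAG (Fin p)) (I : Fin (K + 1) → Finset (Fin p)) :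
    ℕ :=
  p + G.numEdges + ∑ k : Fin K, ((I k.succ).card + ∑ i ∈ I k.succ, (G.pa i).card)

/-- The total sample size. -/
def totalSize {K : ℕ} (n : Fin (K + 1) → ℕ) : ℕ := ∑ k, n k

/-- The Bayesian information criterion of the Gaussian `I`-DAG model of `G` and `I` for the data
`x`, where `θ` is the maximum likelihood estimate in this model. -/
noncomputable def BIC {p K : ℕ} {n : Fin (K + 1) → ℕ} (I : Fin (K + 1) → Finset (Fin p))
    (x : Dataset p K n) (G : DAG (Fin p)) (θ : GaussParams p K) : ℝ :=
  Real.log (likelihood x θ) - numFreeParams G I * Real.log (totalSize n) / 2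

/-! ## The data vector and its Möbius transform -/

/-- The sample covariance matrix of the pooled data of the experiments in `R`. -/
noncomputable def pooledCov {p K : ℕ} {n : Fin (K + 1) → ℕ} (x : Dataset p K n)
    (R : Finset (Fin (K + 1))) : Matrix (Fin p) (Fin p) ℝ :=
  ((∑ k ∈ R, n k : ℕ) : ℝ)⁻¹ • ∑ k ∈ R, ∑ j, Matrix.vecMulVec (x k j) (x k j)

/-- The submatrix `M_A` of `M` with rows and columns in `A`. -/
def subMat {p : ℕ} (M : Matrix (Fin p) (Fin p) ℝ) (A : Finset (Fin p)) : Matrix A A ℝ :=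
  M.submatrix Subtype.val Subtype.val

/-- The embedding of an `A × A` matrix into a `p × p` matrix, all other entries being zero. -/
noncomputable def fillZero {p : ℕ} (A : Finset (Fin p)) (M : Matrix A A ℝ) :
    Matrix (Fin p) (Fin p) ℝ :=
  fun i j => if h : i ∈ A ∧ j ∈ A then M ⟨i, h.1⟩ ⟨j, h.2⟩ else 0

/-- The contribution of experiment `k` to a coordinate of the data vector, for the sample
covariance matrix `S`. -/
noncomputable def dataTerm {p K : ℕ} {n : Fin (K + 1) → ℕ} (x : Dataset p K n) (A : Finset (Fin p))
    (S : Matrix (Fin p) (Fin p) ℝ) (k : Fin (K + 1)) : ℝ :=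
  (1 / 2) * ∑ j, x k j ⬝ᵥ (fillZero A (subMat S A)⁻¹).mulVec (x k j)
    + ((n k : ℝ) / 2) * Real.log (subMat S A).det

/-- The coordinate `α_{A ⊔ 𝒵}` of the data vector, where `Z` is the set of indices of the nodes in
`𝒵` and `Zᶜ` is its complement in `{0, …, K}`. -/
noncomputable def alphaCoord {p K : ℕ} {n : Fin (K + 1) → ℕ} (x : Dataset p K n)
    (A : Finset (Fin p)) (Z : Finset (Fin (K + 1))) : ℝ :=
  - ∑ k ∈ Zᶜ, dataTerm x A (pooledCov x Zᶜ) k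
  - ∑ k ∈ Z, dataTerm x A (pooledCov x {k}) k
  - (Real.log (totalSize n) / 2) * (A.card.choose 2 : ℝ)
  - (Real.log (totalSize n) / 2) * ∑ _k ∈ Z, (A.card.choose 2 : ℝ)

/-- The data vector `α`, indexed by the sets of nodes of an `I`-DAG. -/
noncomputable def alphaVec {p K : ℕ} {n : Fin (K + 1) → ℕ} (x : Dataset p K n) :
    Finset (Fin p ⊕ Fin K) → ℝ :=
  fun B => alphaCoord x B.toLeft (B.toRight.map (Fin.succEmb K))

/-- The Möbius transform `β` of the data vector:
`β_A = ∑_{B ⊆ A} (-1)^(|A| - |B|) α_B`. -/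
noncomputable def betaVec {p K : ℕ} {n : Fin (K + 1) → ℕ} (x : Dataset p K n) :
    Finset (Fin p ⊕ Fin K) → ℝ :=
  fun A => ∑ B ∈ A.powerset, (-1 : ℝ) ^ (A.card - B.card) * alphaVec x B

/-! ## The optimization problem -/

/-- `y` is an optimal solution of the linear program `maximize b ⬝ y` subject to `y ∈ P`. -/
def IsLPSolution {ι : Type} [Fintype ι] (b : ι → ℝ) (P : Set (ι → ℝ)) (y : ι → ℝ) : Prop :=
  y ∈ P ∧ ∀ z ∈ P, b ⬝ᵥ z ≤ b ⬝ᵥ y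

/-- `G` is BIC-optimal among all DAGs, where `θ H` is the maximum likelihood estimate in the
Gaussian `I`-DAG model of `H`. -/
def IsBICOptimal {p K : ℕ} {n : Fin (K + 1) → ℕ} (I : Fin (K + 1) → Finset (Fin p))
    (x : Dataset p K n) (θ : DAG (Fin p) → GaussParams p K) (G : DAG (Fin p)) : Prop :=
  ∀ H : DAG (Fin p), BIC I x H (θ H) ≤ BIC I x G (θ G)

/-! The objective at `c_{G^I}` is the BIC of `G` plus a constant that does not depend on `G`. The
rest is linear programming over the convex hull of finitely many points.

Möbius inversion turns `β · c_D` into `α_∅ + ∑_v (α_{fa v} - α_{pa v})` for every DAG `D`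
(`DAG.moebius_dotProduct_charImset`). In an `I`-DAG the roots `z_k` contribute constants. At a node
`i` of `[p]` the nodes `z_k` among the parents record the experiments targeting `i`, and `α_{fa i} -
α_{pa i}` has to be the maximized log-likelihood of that node, up to constants, minus its penalty.

The log-likelihood is a sum over nodes, and the parameters of a node are shared by the experiments
not targeting it and free in each of the others. So the MLE solves one least-squares problem for
each such block of experiments (`IsMLE.isNodeMin`). With `N` observations and residual variance `σ`
the minimal loss is `N/2 (log σ + 1)`. By the Schur complement `σ = det S_{A ∪ {i}} / det S_A`, so
this is a difference of data terms (`IsNodeMin.nodeLoss_eq_sum_dataTerm`). Uniqueness of the MLE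
forces `N`, `det S_A` and `σ` to be nonzero, so the conventions for degenerate data play no role in
these differences. -/

/-! ### Möbius inversion and characteristic imsets -/

theorem sum_powerset_moebius {V : Type} (α : Finset V → ℝ) (T : Finset V) :
    ∑ A ∈ T.powerset, ∑ B ∈ A.powerset, (-1 : ℝ) ^ (A.card - B.card) * α B = α T := by
  rw [Finset.sum_comm' (t' := T.powerset) (s' := fun B => Finset.Icc B T)
    (by
      intro A B
      simp only [Finset.mem_powerset, Finset.mem_Icc]
      exact ⟨fun h => ⟨⟨h.2, h.1⟩, h.2.trans h.1⟩, fun h => ⟨h.1.2, h.1.1⟩⟩)]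
  rw [Finset.sum_eq_single_of_mem T (Finset.mem_powerset_self T)]
  · simp
  · intro B hB hne
    rw [Finset.mem_powerset] at hB
    -- The interval `[B, T]` consists of the sets `B ∪ C` with `C ⊆ T \ B`. The signs `(-1)^|C|`
    -- cancel because `T \ B` is nonempty.
    rw [← Finset.sum_mul, Finset.Icc_eq_image_powerset hB, Finset.sum_image]
    · have h : ∀ C ∈ (T \ B).powerset, (-1 : ℝ) ^ ((B ∪ C).card - B.card) = (-1) ^ C.card := by
        intro C hC
        rw [Finset.mem_powerset] at hC
        rw [Finset.card_union_of_disjoint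
          (Finset.disjoint_of_subset_right hC Finset.disjoint_sdiff), Nat.add_sub_cancel_left]
      rw [Finset.sum_congr rfl h]
      have h0 := Finset.sum_powerset_neg_one_pow_card_of_nonempty (x := T \ B)
        (Finset.sdiff_nonempty.mpr fun h => hne (hB.antisymm h))
      have h1 : ∑ C ∈ (T \ B).powerset, (-1 : ℝ) ^ C.card = 0 := by exact_mod_cast h0
      rw [h1, zero_mul]
    · intro C hC D hD h
      simp only [Finset.coe_powerset, Set.mem_preimage, Set.mem_powerset_iff,
        Finset.coe_subset] at hC hD
      have hC' := Finset.disjoint_of_subset_right hC Finset.disjoint_sdiff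
      have hD' := Finset.disjoint_of_subset_right hD Finset.disjoint_sdiff
      have := congrArg (· \ B) h
      simpa [Finset.union_sdiff_cancel_left hC', Finset.union_sdiff_cancel_left hD'] using this

theorem DAG.sum_mul_standardImset {V : Type} [Fintype V] (G : DAG V) (α : Finset V → ℝ) :
    ∑ T, α T * G.standardImset T =
      α Finset.univ - α ∅ + ∑ v, (α (G.pa v) - α (G.fa v)) := by
  have hδ : ∀ A : Finset V, ∑ T, α T * DAG.delta A T = α A := by
    intro A
    simp [DAG.delta]
  simp only [DAG.standardImset, Pi.add_apply, Pi.sub_apply, Finset.sum_apply, mul_add, mul_sub,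
    Finset.mul_sum, Finset.sum_add_distrib, Finset.sum_sub_distrib, hδ]
  congr 1
  rw [Finset.sum_comm]
  rw [Finset.sum_comm (f := fun T v => α T * DAG.delta (G.fa v) T)]
  simp only [hδ]

/-- Summation over supersets is adjoint to summation over subsets, and the latter undoes the Möbius
transform. What remains is a pairing of `α` with the standard imset, in which the two terms at the
full set cancel. -/
theorem DAG.moebius_dotProduct_charImset {V : Type} [Fintype V] (G : DAG V)
    (α : Finset V → ℝ) :
    (fun A => ∑ B ∈ A.powerset, (-1 : ℝ) ^ (A.card - B.card) * α B) ⬝ᵥ G.charImset =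
      α ∅ + ∑ v, (α (G.fa v) - α (G.pa v)) := by
  have h1 := sum_powerset_moebius α
  set β : Finset V → ℝ := fun A => ∑ B ∈ A.powerset, (-1 : ℝ) ^ (A.card - B.card) * α B
    with hβ
  have h2 : ∑ S, ∑ T ∈ Finset.univ.filter (fun T => S ⊆ T), β S * G.standardImset T =
      ∑ T, α T * G.standardImset T := by
    rw [Finset.sum_comm' (t' := Finset.univ) (s' := fun T => T.powerset) (by simp)]
    refine Finset.sum_congr rfl fun T _ => ?_
    rw [← Finset.sum_mul, ← h1 T]
  have h3 : ∑ S, β S = α Finset.univ := by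
    rw [← h1 Finset.univ, Finset.powerset_univ]
  simp only [dotProduct, DAG.charImset, mul_sub, mul_one, Finset.sum_sub_distrib,
    Finset.mul_sum]
  rw [h2, h3, G.sum_mul_standardImset]
  simp only [Finset.sum_sub_distrib]
  ring

/-! ### Linear programs over the convex hull of a family -/

theorem dotProduct_mem_convexHull_le {ι κ : Type} [Fintype κ] (b : κ → ℝ)
    (c : ι → κ → ℝ) (m : ℝ) (hm : ∀ i, b ⬝ᵥ c i ≤ m) (y : κ → ℝ)
    (hy : y ∈ convexHull ℝ (Set.range c)) : b ⬝ᵥ y ≤ m := by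
  have hconv : Convex ℝ {z : κ → ℝ | b ⬝ᵥ z ≤ m} := by
    refine convex_halfSpace_le (f := fun z => b ⬝ᵥ z) ?_ m
    exact ⟨dotProduct_add b, fun r z => dotProduct_smul r b z⟩
  exact convexHull_min (by rintro _ ⟨i, rfl⟩; exact hm i) hconv hy

theorem isLPSolution_convexHull_iff {ι κ : Type} [Fintype κ] (b : κ → ℝ)
    (c : ι → κ → ℝ) (i : ι) :
    IsLPSolution b (convexHull ℝ (Set.range c)) (c i) ↔ ∀ j, b ⬝ᵥ c j ≤ b ⬝ᵥ c i :=
  ⟨fun h j => h.2 _ (subset_convexHull ℝ _ ⟨j, rfl⟩), fun h =>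
    ⟨subset_convexHull ℝ _ ⟨i, rfl⟩, dotProduct_mem_convexHull_le b c _ h⟩⟩

/-- A convex combination attains the maximum only if all its weight lies on maximizing points. -/
theorem setOf_isLPSolution_convexHull {ι κ : Type} [Finite ι] [Fintype κ]
    (b : κ → ℝ) (c : ι → κ → ℝ) (i₀ : ι) (hi₀ : ∀ j, b ⬝ᵥ c j ≤ b ⬝ᵥ c i₀) :
    {y | IsLPSolution b (convexHull ℝ (Set.range c)) y} =
      convexHull ℝ {y | ∃ i, (∀ j, b ⬝ᵥ c j ≤ b ⬝ᵥ c i) ∧ y = c i} := by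
  have := Fintype.ofFinite ι
  apply Set.Subset.antisymm
  · rintro y ⟨hy, hmax⟩
    have hge : b ⬝ᵥ c i₀ ≤ b ⬝ᵥ y := hmax _ (subset_convexHull ℝ _ ⟨i₀, rfl⟩)
    rw [convexHull_range_eq_exists_affineCombination] at hy
    obtain ⟨s, w, hw0, hw1, rfl⟩ := hy
    rw [Finset.affineCombination_eq_linear_combination _ _ _ hw1] at hge ⊢
    have hzero : ∀ i ∈ s, w i * (b ⬝ᵥ c i₀ - b ⬝ᵥ c i) = 0 := by
      rw [← Finset.sum_eq_zero_iff_of_nonneg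
        fun i hi => mul_nonneg (hw0 i hi) (sub_nonneg.mpr (hi₀ i))]
      refine le_antisymm ?_ (Finset.sum_nonneg
        fun i hi => mul_nonneg (hw0 i hi) (sub_nonneg.mpr (hi₀ i)))
      simp only [mul_sub, Finset.sum_sub_distrib, ← Finset.sum_mul, hw1]
      simp only [dotProduct_sum, dotProduct_smul, smul_eq_mul] at hge
      linarith
    -- Points of weight zero need not be optimal; replacing them by the optimal `c i₀` makes every
    -- point of the combination a maximizer.
    have hsum : ∑ i ∈ s, w i • c i = ∑ i ∈ s, w i • (if w i = 0 then c i₀ else c i) := by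
      refine Finset.sum_congr rfl fun i _ => ?_
      split_ifs with h <;> simp [h]
    rw [hsum]
    refine (convex_convexHull ℝ _).sum_mem hw0 hw1 fun i hi => subset_convexHull ℝ _ ?_
    split_ifs with h
    · exact ⟨i₀, hi₀, rfl⟩
    · have hi' := (mul_eq_zero.mp (hzero i hi)).resolve_left h
      exact ⟨i, fun j => (hi₀ j).trans (sub_eq_zero.mp hi').le, rfl⟩
  · refine convexHull_min ?_ ?_
    · rintro _ ⟨i, hi, rfl⟩
      exact (isLPSolution_convexHull_iff b c i).mpr hi
    · rintro y ⟨hy, hym⟩ z ⟨hz, hzm⟩ s t hs ht hst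
      refine ⟨convex_convexHull ℝ _ hy hz hs ht hst, fun u hu => ?_⟩
      rw [dotProduct_add, dotProduct_smul, dotProduct_smul, smul_eq_mul, smul_eq_mul]
      have h1 := mul_le_mul_of_nonneg_left (hym u hu) hs
      have h2 := mul_le_mul_of_nonneg_left (hzm u hu) ht
      calc b ⬝ᵥ u = s * (b ⬝ᵥ u) + t * (b ⬝ᵥ u) := by rw [← add_mul, hst, one_mul]
        _ ≤ _ := add_le_add h1 h2

instance DAG.finite {V : Type} [Finite V] : Finite (DAG V) := by
  refine Finite.of_injective (fun G : DAG V => G.Adj) ?_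
  rintro ⟨⟨A⟩, hA⟩ ⟨⟨B⟩, hB⟩ h
  cases (h : A = B)
  rfl

/-! ### Factorization of the Gaussian likelihood over the nodes -/

/-- In the Leibniz expansion, a nonzero term of a permutation `σ ≠ 1` would make every moved `j` a
parent of `σ j`, so that an orbit of `σ` would be a directed cycle. -/
theorem DAG.det_one_sub {p : ℕ} (G : DAG (Fin p)) (Λ : Matrix (Fin p) (Fin p) ℝ)
    (hΛ : ∀ i j, ¬ G.Adj j i → Λ i j = 0) : (1 - Λ).det = 1 := by
  have hdiag : ∀ i, Λ i i = 0 := fun i =>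
    hΛ i i fun h => G.acyclic i (Relation.TransGen.single h)
  rw [Matrix.det_apply, Finset.sum_eq_single_of_mem 1 (Finset.mem_univ _)]
  · simp [hdiag]
  · intro σ _ hσ
    by_contra hne
    obtain ⟨i, hi⟩ : ∃ i, σ i ≠ i := by
      by_contra! h
      exact hσ (Equiv.ext h)
    have hprod : ∏ j, (1 - Λ) (σ j) j ≠ 0 := fun h => hne (by rw [h, smul_zero])
    have hadj : ∀ j, σ j ≠ j → G.Adj j (σ j) := by
      intro j hj
      by_contra h
      exact hprod (Finset.prod_eq_zero (Finset.mem_univ j) (by simp [hj, hΛ _ _ h]))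
    have hmove : ∀ m : ℕ, σ ((σ ^ m) i) ≠ (σ ^ m) i := by
      intro m h
      apply hi
      apply (σ ^ m).injective
      rw [← Equiv.Perm.mul_apply, ← pow_succ, pow_succ', Equiv.Perm.mul_apply, h]
    have htrans : ∀ m : ℕ, Relation.TransGen G.Adj i ((σ ^ (m + 1)) i) := by
      intro m
      induction m with
      | zero => exact Relation.TransGen.single (by simpa using hadj i hi)
      | succ m ih =>
        refine ih.tail ?_
        rw [pow_succ' σ (m + 1), Equiv.Perm.mul_apply]
        exact hadj _ (hmove _)
    have hcycle := htrans (orderOf σ - 1)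
    rw [Nat.sub_add_cancel (orderOf_pos σ), pow_orderOf_eq_one] at hcycle
    exact G.acyclic i hcycle

/-- The precision matrix is `(1 - Λ)ᵀ diag(1/ω) (1 - Λ)` and the covariance has determinant `∏ ω_i`,
so both the quadratic form and the log-determinant split over the nodes. -/
theorem log_gaussDensity_gaussCov {p : ℕ} (Λ : Matrix (Fin p) (Fin p) ℝ) (ω : Fin p → ℝ)
    (hdet : (1 - Λ).det = 1) (hω : ∀ i, 0 < ω i) (v : Fin p → ℝ) :
    0 < gaussDensity (gaussCov Λ ω) v ∧
    Real.log (gaussDensity (gaussCov Λ ω) v) =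
      -(p * Real.log (2 * Real.pi) / 2) -
        ∑ i, (Real.log (ω i) / 2 + (v i - Λ i ⬝ᵥ v) ^ 2 / (2 * ω i)) := by
  have hunit : IsUnit (1 - Λ).det := by simp [hdet]
  have hprod : 0 < ∏ i, ω i := Finset.prod_pos fun i _ => hω i
  have hdetCov : (gaussCov Λ ω).det = ∏ i, ω i := by
    simp [gaussCov, Matrix.det_nonsing_inv, hdet]
  have hinv : (gaussCov Λ ω)⁻¹ =
      (1 - Λ).transpose * (Matrix.diagonal fun i => (ω i)⁻¹) * (1 - Λ) := by
    apply Matrix.inv_eq_left_inv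
    have h1 : (1 - Λ) * (1 - Λ)⁻¹ = 1 := Matrix.mul_nonsing_inv _ hunit
    have h2 : (1 - Λ).transpose * ((1 - Λ)⁻¹).transpose = 1 := by
      rw [← Matrix.transpose_mul, Matrix.nonsing_inv_mul _ hunit, Matrix.transpose_one]
    have h3 : Matrix.diagonal (fun i => (ω i)⁻¹) * Matrix.diagonal ω = 1 := by
      rw [Matrix.diagonal_mul_diagonal, ← Matrix.diagonal_one]
      congr 1
      ext i
      exact inv_mul_cancel₀ (hω i).ne'
    calc _ = (1 - Λ).transpose * ((Matrix.diagonal fun i => (ω i)⁻¹) *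
          ((1 - Λ) * (1 - Λ)⁻¹) * Matrix.diagonal ω) * ((1 - Λ)⁻¹).transpose := by
            simp only [gaussCov, Matrix.mul_assoc]
      _ = 1 := by rw [h1, Matrix.mul_one, h3, Matrix.mul_one, h2]
  have hquad : v ⬝ᵥ (gaussCov Λ ω)⁻¹.mulVec v = ∑ i, (v i - Λ i ⬝ᵥ v) ^ 2 / ω i := by
    rw [hinv, ← Matrix.mulVec_mulVec, ← Matrix.mulVec_mulVec, Matrix.dotProduct_mulVec,
      Matrix.vecMul_transpose]
    simp only [dotProduct, Matrix.mulVec_diagonal, Matrix.sub_mulVec, Matrix.one_mulVec,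
      Pi.sub_apply]
    refine Finset.sum_congr rfl fun i _ => ?_
    simp only [Matrix.mulVec, dotProduct]
    ring
  have hpi : 0 < (2 * Real.pi) ^ p := by positivity
  have hsqrt : 0 < Real.sqrt ((2 * Real.pi) ^ p * (gaussCov Λ ω).det) := by
    rw [hdetCov]; positivity
  refine ⟨mul_pos (inv_pos.mpr hsqrt) (Real.exp_pos _), ?_⟩
  rw [gaussDensity, Real.log_mul (inv_pos.mpr hsqrt).ne' (Real.exp_pos _).ne', Real.log_exp,
    Real.log_inv, Real.log_sqrt (by rw [hdetCov]; positivity), hquad, hdetCov,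
    Real.log_mul hpi.ne' hprod.ne', Real.log_pow, Real.log_prod fun i _ => (hω i).ne',
    Finset.sum_add_distrib, ← Finset.sum_div]
  have h : ∑ i, (v i - Λ i ⬝ᵥ v) ^ 2 / (2 * ω i) = (∑ i, (v i - Λ i ⬝ᵥ v) ^ 2 / ω i) / 2 := by
    rw [Finset.sum_div]
    refine Finset.sum_congr rfl fun i _ => ?_
    rw [div_div, mul_comm]
  rw [h]
  ring

/-- The contribution of node `i` to the negative log-likelihood of the experiments in `R`, when
the regression coefficients are `l` and the error variance is `w`. -/
noncomputable def nodeLoss {p K : ℕ} {n : Fin (K + 1) → ℕ} (x : Dataset p K n)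
    (R : Finset (Fin (K + 1))) (i : Fin p) (l : Fin p → ℝ) (w : ℝ) : ℝ :=
  ∑ k ∈ R, ∑ j, (Real.log w / 2 + (x k j i - l ⬝ᵥ x k j) ^ 2 / (2 * w))

theorem log_likelihood {p K : ℕ} {n : Fin (K + 1) → ℕ} (x : Dataset p K n) (G : DAG (Fin p))
    (I : Fin (K + 1) → Finset (Fin p)) (θ : GaussParams p K) (hθ : θ ∈ paramSpace G I) :
    0 < likelihood x θ ∧ Real.log (likelihood x θ) =
      -(totalSize n * (p * Real.log (2 * Real.pi) / 2)) -
        ∑ k, ∑ i, nodeLoss x {k} i ((θ k).1 i) ((θ k).2 i) := by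
  have h := fun k j => log_gaussDensity_gaussCov (θ k).1 (θ k).2
    (G.det_one_sub _ (hθ.1 k)) (hθ.2.1 k) (x k j)
  refine ⟨Finset.prod_pos fun k _ => Finset.prod_pos fun j _ => (h k j).1, ?_⟩
  rw [likelihood, Real.log_prod fun k _ => (Finset.prod_pos fun j _ => (h k j).1).ne']
  simp_rw [Real.log_prod fun j (_ : j ∈ Finset.univ) => (h _ j).1.ne', (h _ _).2,
    nodeLoss, Finset.sum_singleton, Finset.sum_sub_distrib, totalSize]
  congr 1
  · simp [Finset.sum_mul]
  · exact Finset.sum_congr rfl fun k _ => Finset.sum_comm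

theorem nodeLoss_eq_sum {p K : ℕ} {n : Fin (K + 1) → ℕ} (x : Dataset p K n)
    (R : Finset (Fin (K + 1))) (i : Fin p) (l : Fin p → ℝ) (w : ℝ) :
    nodeLoss x R i l w = ∑ k ∈ R, nodeLoss x {k} i l w := by
  simp [nodeLoss]

/-! ### Reduction of the MLE to single nodes -/

/-- The parameters `θ` with those of node `i` in the experiments of `R` replaced. -/
noncomputable def replaceNode {p K : ℕ} (θ : GaussParams p K) (R : Finset (Fin (K + 1)))
    (i : Fin p) (l : Fin p → ℝ) (w : ℝ) : GaussParams p K :=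
  fun k => if k ∈ R then ((θ k).1.updateRow i l, Function.update (θ k).2 i w) else θ k

/-- By `hR`, the experiments not targeting `i` are changed all together or not at all, which
preserves the equalities between their parameters. -/
theorem replaceNode_mem_paramSpace {p K : ℕ} {G : DAG (Fin p)}
    {I : Fin (K + 1) → Finset (Fin p)} {θ : GaussParams p K} (hθ : θ ∈ paramSpace G I)
    {R : Finset (Fin (K + 1))} {i : Fin p} (hR : ∀ k, i ∉ I k → (k ∈ R ↔ 0 ∈ R))
    {l : Fin p → ℝ} (hl : ∀ j ∉ G.pa i, l j = 0) {w : ℝ} (hw : 0 < w) :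
    replaceNode θ R i l w ∈ paramSpace G I := by
  refine ⟨fun k a b hab => ?_, fun k a => ?_, fun k a ha => ?_⟩
  · by_cases hk : k ∈ R
    · by_cases hai : a = i
      · subst hai
        simp [replaceNode, hk, hl b (by simpa [DAG.pa] using hab)]
      · simp [replaceNode, hk, hai, hθ.1 k a b hab]
    · simp [replaceNode, hk, hθ.1 k a b hab]
  · by_cases hk : k ∈ R
    · by_cases hai : a = i
      · subst hai
        simpa [replaceNode, hk] using hw
      · simp [replaceNode, hk, hai, hθ.2.1 k a]
    · simp [replaceNode, hk, hθ.2.1 k a]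
  · have h := hθ.2.2 k a ha
    by_cases hai : a = i
    · subst hai
      have h0 := hR k ha
      by_cases hk : k ∈ R
      · simp [replaceNode, hk, h0.mp hk]
      · have hk0 : (0 : Fin (K + 1)) ∉ R := fun h => hk (h0.mpr h)
        simpa [replaceNode, hk, hk0] using h
    · by_cases hk : k ∈ R <;> by_cases h0 : (0 : Fin (K + 1)) ∈ R <;>
        simpa [replaceNode, hk, h0, hai] using h

theorem sum_nodeLoss_replaceNode {p K : ℕ} {n : Fin (K + 1) → ℕ} (x : Dataset p K n)
    (θ : GaussParams p K) (R : Finset (Fin (K + 1))) (i : Fin p)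
    (l : Fin p → ℝ) (w : ℝ) (l₀ : Fin p → ℝ) (w₀ : ℝ)
    (h₀ : ∀ k ∈ R, (θ k).1 i = l₀ ∧ (θ k).2 i = w₀) :
    ∑ k, ∑ a, nodeLoss x {k} a ((replaceNode θ R i l w k).1 a) ((replaceNode θ R i l w k).2 a) =
      ∑ k, ∑ a, nodeLoss x {k} a ((θ k).1 a) ((θ k).2 a) +
        (nodeLoss x R i l w - nodeLoss x R i l₀ w₀) := by
  rw [nodeLoss_eq_sum x R i l w, nodeLoss_eq_sum x R i l₀ w₀, ← sub_eq_iff_eq_add',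
    ← Finset.sum_sub_distrib, ← Finset.sum_sub_distrib,
    ← Finset.sum_subset (Finset.subset_univ R)]
  · refine Finset.sum_congr rfl fun k hk => ?_
    rw [← Finset.sum_sub_distrib, Finset.sum_eq_single_of_mem i (Finset.mem_univ i)]
    · simp [replaceNode, hk, h₀ k hk]
    · intro a _ ha
      simp [replaceNode, hk, ha]
  · intro k _ hk
    simp [replaceNode, hk]

/-- `(l, w)` is the unique minimizer of the loss of node `i` in the experiments of `R`, among the
coefficients supported in `A` and the positive variances. -/
def IsNodeMin {p K : ℕ} {n : Fin (K + 1) → ℕ} (x : Dataset p K n)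
    (R : Finset (Fin (K + 1))) (i : Fin p) (A : Finset (Fin p)) (l : Fin p → ℝ) (w : ℝ) : Prop :=
  ((∀ j ∉ A, l j = 0) ∧ 0 < w) ∧ ∀ l' w', (∀ j ∉ A, l' j = 0) → 0 < w' → (l', w') ≠ (l, w) →
    nodeLoss x R i l w < nodeLoss x R i l' w'

/-- Replacing the parameters of `i` over `R` changes only that block of the log-likelihood, so
strict optimality passes from `θ` to the block. -/
theorem IsMLE.isNodeMin {p K : ℕ} {n : Fin (K + 1) → ℕ} {I : Fin (K + 1) → Finset (Fin p)}
    {x : Dataset p K n} {G : DAG (Fin p)} {θ : GaussParams p K} (hθ : IsMLE I x G θ)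
    {R : Finset (Fin (K + 1))} {i : Fin p} (hR : ∀ k, i ∉ I k → (k ∈ R ↔ 0 ∈ R))
    {k₀ : Fin (K + 1)} (hk₀ : k₀ ∈ R)
    (h₀ : ∀ k ∈ R, (θ k).1 i = (θ k₀).1 i ∧ (θ k).2 i = (θ k₀).2 i) :
    IsNodeMin x R i (G.pa i) ((θ k₀).1 i) ((θ k₀).2 i) := by
  refine ⟨⟨fun j hj => hθ.1.1 k₀ i j (by simpa [DAG.pa] using hj), hθ.1.2.1 k₀ i⟩,
    fun l w hl hw hne => ?_⟩
  have hmem := replaceNode_mem_paramSpace hθ.1 hR hl hw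
  have hne' : replaceNode θ R i l w ≠ θ := by
    intro h
    apply hne
    have h1 := congrFun h k₀
    simp only [replaceNode, hk₀, if_true] at h1
    rw [← h1]
    simp
  have hlt := hθ.2 _ hmem hne'
  have h1 := log_likelihood x G I _ hmem
  have h2 := log_likelihood x G I _ hθ.1
  have h3 := Real.log_lt_log h1.1 hlt
  rw [h1.2, h2.2, sum_nodeLoss_replaceNode x θ R i l w _ _ h₀] at h3
  linarith

/-! ### Sample covariances, data terms and Schur complements -/

/-- The extension by zero of a vector indexed by `A`. -/
noncomputable def extendZero {p : ℕ} (A : Finset (Fin p)) (v : A → ℝ) : Fin p → ℝ :=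
  fun i => if h : i ∈ A then v ⟨i, h⟩ else 0

theorem extendZero_of_notMem {p : ℕ} (A : Finset (Fin p)) (v : A → ℝ) {i : Fin p} (hi : i ∉ A) :
    extendZero A v i = 0 := dif_neg hi

theorem extendZero_dotProduct {p : ℕ} (A : Finset (Fin p)) (v : A → ℝ) (y : Fin p → ℝ) :
    extendZero A v ⬝ᵥ y = ∑ a : A, v a * y a := by
  rw [dotProduct, ← Finset.sum_subset (Finset.subset_univ A), ← Finset.sum_coe_sort]
  · refine Finset.sum_congr rfl fun a _ => ?_
    simp [extendZero]
  · intro i _ hi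
    rw [extendZero_of_notMem A v hi, zero_mul]

theorem mulVec_extendZero {p : ℕ} (M : Matrix (Fin p) (Fin p) ℝ) (A : Finset (Fin p))
    (v : A → ℝ) (i : Fin p) : M.mulVec (extendZero A v) i = ∑ a : A, M i a * v a := by
  rw [Matrix.mulVec, dotProduct_comm, extendZero_dotProduct]
  exact Finset.sum_congr rfl fun a _ => mul_comm _ _

theorem subMat_mulVec {p : ℕ} (M : Matrix (Fin p) (Fin p) ℝ) (A : Finset (Fin p))
    (v : A → ℝ) (a : A) : (subMat M A).mulVec v a = M.mulVec (extendZero A v) a := by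
  rw [mulVec_extendZero]
  rfl

theorem pooledCov_bilin {p K : ℕ} {n : Fin (K + 1) → ℕ} (x : Dataset p K n)
    {R : Finset (Fin (K + 1))} (hN : ((∑ k ∈ R, n k : ℕ) : ℝ) ≠ 0) (u v : Fin p → ℝ) :
    ∑ k ∈ R, ∑ j, (u ⬝ᵥ x k j) * (v ⬝ᵥ x k j) =
      ((∑ k ∈ R, n k : ℕ) : ℝ) * (u ⬝ᵥ (pooledCov x R).mulVec v) := by
  rw [pooledCov, Matrix.smul_mulVec, dotProduct_smul, smul_eq_mul, mul_inv_cancel_left₀ hN]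
  simp only [Matrix.sum_mulVec, dotProduct_sum, Matrix.vecMulVec_mulVec, dotProduct_smul]
  refine Finset.sum_congr rfl fun k _ => Finset.sum_congr rfl fun j _ => ?_
  simp [dotProduct_comm v]

theorem dotProduct_fillZero_mulVec {p : ℕ} (A : Finset (Fin p)) (M : Matrix A A ℝ)
    (v : Fin p → ℝ) :
    v ⬝ᵥ (fillZero A M).mulVec v = ∑ a : A, ∑ b : A, M a b * (v a * v b) := by
  have h : (fillZero A M).mulVec v = extendZero A (M.mulVec fun b => v b) := by
    ext i
    by_cases hi : i ∈ A
    · have : fillZero A M i = extendZero A (M ⟨i, hi⟩) := by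
        ext j
        by_cases hj : j ∈ A <;> simp [fillZero, extendZero, hi, hj]
      rw [Matrix.mulVec, this, extendZero_dotProduct]
      simp [extendZero, hi, Matrix.mulVec, dotProduct]
    · have : fillZero A M i = 0 := by
        ext j
        simp [fillZero, hi]
      rw [Matrix.mulVec, this, zero_dotProduct, extendZero_of_notMem _ _ hi]
  rw [h, dotProduct_comm, extendZero_dotProduct]
  simp only [Matrix.mulVec, dotProduct, Finset.sum_mul]
  exact Finset.sum_congr rfl fun a _ => Finset.sum_congr rfl fun b _ => by ring

/-- Trace trick: the quadratic forms add up to `N tr(M⁻¹ M) = N |A|`, where `N` is the pooled sample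
size. -/
theorem sum_dataTerm {p K : ℕ} {n : Fin (K + 1) → ℕ} (x : Dataset p K n)
    {R : Finset (Fin (K + 1))} (hN : ((∑ k ∈ R, n k : ℕ) : ℝ) ≠ 0) (A : Finset (Fin p))
    (hdet : (subMat (pooledCov x R) A).det ≠ 0) :
    ∑ k ∈ R, dataTerm x A (pooledCov x R) k =
      ((∑ k ∈ R, n k : ℕ) : ℝ) / 2 *
        (A.card + Real.log (subMat (pooledCov x R) A).det) := by
  set M := subMat (pooledCov x R) A with hM
  have hcross : ∀ a b : A, ∑ k ∈ R, ∑ j, x k j a * x k j b =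
      ((∑ k ∈ R, n k : ℕ) : ℝ) * M b a := by
    intro a b
    have h := pooledCov_bilin x hN (Pi.single (b : Fin p) 1) (Pi.single (a : Fin p) 1)
    simp only [single_dotProduct, one_mul, Matrix.mulVec_single_one] at h
    simp only [mul_comm (x _ _ a)]
    exact h
  have htrace : ∑ k ∈ R, ∑ j, x k j ⬝ᵥ (fillZero A M⁻¹).mulVec (x k j) =
      ((∑ k ∈ R, n k : ℕ) : ℝ) * A.card := by
    simp only [dotProduct_fillZero_mulVec]
    have h1 : ∀ k ∈ R, ∑ j, ∑ a : A, ∑ b : A, M⁻¹ a b * (x k j a * x k j b) =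
        ∑ a : A, ∑ b : A, M⁻¹ a b * ∑ j, x k j a * x k j b := by
      intro k _
      rw [Finset.sum_comm]
      refine Finset.sum_congr rfl fun a _ => ?_
      rw [Finset.sum_comm]
      simp only [Finset.mul_sum]
    rw [Finset.sum_congr rfl h1, Finset.sum_comm]
    have h2 : ∀ a : A, ∑ k ∈ R, ∑ b : A, M⁻¹ a b * ∑ j, x k j a * x k j b =
        ((∑ k ∈ R, n k : ℕ) : ℝ) * (M⁻¹ * M) a a := by
      intro a
      rw [Finset.sum_comm, Matrix.mul_apply, Finset.mul_sum]
      refine Finset.sum_congr rfl fun b _ => ?_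
      rw [← Finset.mul_sum, hcross]
      ring
    rw [Finset.sum_congr rfl fun a _ => h2 a, ← Finset.mul_sum,
      Matrix.nonsing_inv_mul _ (isUnit_iff_ne_zero.mpr hdet)]
    simp
  simp only [dataTerm, Finset.sum_add_distrib, ← Finset.mul_sum, ← Finset.sum_mul,
    ← Finset.sum_div]
  rw [htrace]
  push_cast
  ring

/-- The second factor is the Schur complement of the block `A`. For a sample covariance it is the
residual variance of regressing `i` on `A`. -/
theorem det_subMat_insert {p : ℕ} (M : Matrix (Fin p) (Fin p) ℝ)
    (A : Finset (Fin p)) {i : Fin p} (hi : i ∉ A) (hdet : (subMat M A).det ≠ 0) :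
    (subMat M (insert i A)).det = (subMat M A).det *
      (M i i - M.mulVec (extendZero A ((subMat M A)⁻¹.mulVec fun a => M a i)) i) := by
  let e : A ⊕ Unit ≃ (insert i A : Finset (Fin p)) :=
    ((Finset.subtypeInsertEquivOption hi).trans (Equiv.optionEquivSumPUnit _)).symm
  have hl : ∀ a : A, (e (Sum.inl a) : Fin p) = a := by
    intro a
    simp [e, Finset.subtypeInsertEquivOption]
  have hr : ∀ u : Unit, (e (Sum.inr u) : Fin p) = i := by
    intro u
    simp [e, Finset.subtypeInsertEquivOption]
  have := Matrix.invertibleOfIsUnitDet _ (isUnit_iff_ne_zero.mpr hdet)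
  rw [← Matrix.det_submatrix_equiv_self e]
  have hblock : (subMat M (insert i A)).submatrix e e =
      Matrix.fromBlocks (subMat M A) (Matrix.of fun a _ => M a i) (Matrix.of fun _ a => M i a)
        (Matrix.of fun _ _ => M i i) := by
    ext (a | a) (b | b) <;> simp [subMat, hl, hr]
  rw [hblock, Matrix.det_fromBlocks₁₁, Matrix.det_unique (n := Unit), Matrix.invOf_eq_nonsing_inv,
    mulVec_extendZero, Matrix.mul_assoc]
  rfl

/-! ### The least-squares problem of one node -/

/-- The residual sum of squares of node `i` in the experiments of `R`. -/
noncomputable def residualSS {p K : ℕ} {n : Fin (K + 1) → ℕ} (x : Dataset p K n)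
    (R : Finset (Fin (K + 1))) (i : Fin p) (l : Fin p → ℝ) : ℝ :=
  ∑ k ∈ R, ∑ j, (x k j i - l ⬝ᵥ x k j) ^ 2

theorem nodeLoss_eq {p K : ℕ} {n : Fin (K + 1) → ℕ} (x : Dataset p K n)
    (R : Finset (Fin (K + 1))) (i : Fin p) (l : Fin p → ℝ) (w : ℝ) :
    nodeLoss x R i l w =
      ((∑ k ∈ R, n k : ℕ) : ℝ) / 2 * Real.log w + residualSS x R i l / (2 * w) := by
  simp only [nodeLoss, residualSS, Finset.sum_add_distrib, Finset.sum_div, Finset.sum_const,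
    Finset.card_univ, Fintype.card_fin, nsmul_eq_mul, ← Finset.sum_mul]
  push_cast
  ring

section NodeMin

variable {p K : ℕ} {n : Fin (K + 1) → ℕ} {x : Dataset p K n} {R : Finset (Fin (K + 1))}
  {i : Fin p} {A : Finset (Fin p)} {l : Fin p → ℝ} {w : ℝ}

/-- Without data the loss vanishes identically and no minimizer is unique. -/
theorem IsNodeMin.sampleSize_pos (h : IsNodeMin x R i A l w) :
    (0 : ℝ) < ((∑ k ∈ R, n k : ℕ) : ℝ) := by
  rw [Nat.cast_pos]
  by_contra hN
  have hn : ∀ k ∈ R, n k = 0 := by simpa using hN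
  have hzero : ∀ w', nodeLoss x R i l w' = 0 := by
    intro w'
    refine Finset.sum_eq_zero fun k hk => Finset.sum_eq_zero fun j _ => ?_
    exact absurd j.2 (by simp [hn k hk])
  have := h.2 l (w + 1) h.1.1 (by linarith [h.1.2]) (by simp)
  rw [hzero, hzero] at this
  exact lt_irrefl _ this

/-- A kernel vector of the sample covariance is orthogonal to every observation in `R`; adding it to
`l` leaves the loss unchanged and contradicts uniqueness. -/
theorem IsNodeMin.det_ne_zero (h : IsNodeMin x R i A l w) :
    (subMat (pooledCov x R) A).det ≠ 0 := by
  intro hdet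
  obtain ⟨v, hv, hv0⟩ := Matrix.exists_mulVec_eq_zero_iff.mpr hdet
  have hsq := pooledCov_bilin x h.sampleSize_pos.ne' (extendZero A v) (extendZero A v)
  have hz : extendZero A v ⬝ᵥ (pooledCov x R).mulVec (extendZero A v) = 0 := by
    rw [extendZero_dotProduct]
    refine Finset.sum_eq_zero fun a _ => ?_
    rw [← subMat_mulVec, hv0, Pi.zero_apply, mul_zero]
  rw [hz, mul_zero, Finset.sum_eq_zero_iff_of_nonneg
    fun k _ => Finset.sum_nonneg fun j _ => mul_self_nonneg _] at hsq
  have horth : ∀ k ∈ R, ∀ j, extendZero A v ⬝ᵥ x k j = 0 := by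
    intro k hk j
    have := (Finset.sum_eq_zero_iff_of_nonneg fun j _ => mul_self_nonneg _).mp (hsq k hk) j
      (Finset.mem_univ j)
    exact mul_self_eq_zero.mp this
  refine absurd (h.2 (l + extendZero A v) w ?_ h.1.2 ?_) ?_
  · intro j hj
    simp [h.1.1 j hj, extendZero_of_notMem A v hj]
  · intro heq
    apply hv
    have h0 : extendZero A v = 0 := by simpa using heq
    ext a
    simpa [extendZero] using congrFun h0 a
  · rw [not_lt]
    refine (Finset.sum_congr rfl fun k hk => Finset.sum_congr rfl fun j _ => ?_).le
    rw [add_dotProduct, horth k hk j, add_zero]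

/-- The minimizer `(l, w)` need not be identified: comparison with the regression solution `(m, σ)`
bounds its loss from above, and minimality of the residual sum of squares at `m` bounds it from
below. -/
theorem IsNodeMin.nodeLoss_eq_sum_dataTerm (h : IsNodeMin x R i A l w) (hi : i ∉ A) :
    nodeLoss x R i l w =
      ∑ k ∈ R, dataTerm x (insert i A) (pooledCov x R) k -
        ∑ k ∈ R, dataTerm x A (pooledCov x R) k := by
  have hN := h.sampleSize_pos
  have hdet := h.det_ne_zero
  set N : ℝ := ((∑ k ∈ R, n k : ℕ) : ℝ) with hNdef
  set S := pooledCov x R with hS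
  set m : Fin p → ℝ := extendZero A ((subMat S A)⁻¹.mulVec fun a => S a i) with hm
  set σ : ℝ := S i i - S.mulVec m i with hσ
  have hresid : ∀ k j, (Pi.single i 1 - m) ⬝ᵥ x k j = x k j i - m ⬝ᵥ x k j := by
    intro k j
    simp [sub_dotProduct]
  have hSr : ∀ a, S.mulVec (Pi.single i 1 - m) a = S a i - S.mulVec m a := by
    intro a
    simp [Matrix.mulVec_sub]
  -- Normal equations: the residual of `m` is orthogonal to every combination of the variables in
  -- `A`.
  have hnormal : ∀ u : Fin p → ℝ, (∀ j ∉ A, u j = 0) →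
      ∑ k ∈ R, ∑ j, (u ⬝ᵥ x k j) * (x k j i - m ⬝ᵥ x k j) = 0 := by
    intro u hu
    have h1 := pooledCov_bilin x hN.ne' u (Pi.single i 1 - m)
    simp only [hresid] at h1
    rw [h1]
    refine mul_eq_zero_of_right _ (Finset.sum_eq_zero fun a _ => ?_)
    by_cases ha : a ∈ A
    · rw [← hS, hSr, hm, ← subMat_mulVec S A _ ⟨a, ha⟩, Matrix.mulVec_mulVec,
        Matrix.mul_nonsing_inv _ (isUnit_iff_ne_zero.mpr hdet), Matrix.one_mulVec, sub_self,
        mul_zero]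
    · rw [hu a ha, zero_mul]
  have hm0 : ∀ j ∉ A, m j = 0 := fun j hj => extendZero_of_notMem A _ hj
  have hRSSm : residualSS x R i m = N * σ := by
    have h1 := pooledCov_bilin x hN.ne' (Pi.single i 1) (Pi.single i 1 - m)
    simp only [hresid, single_dotProduct, one_mul] at h1
    rw [← hS, hSr] at h1
    rw [hσ, ← h1, ← sub_zero (∑ k ∈ R, _), ← hnormal m hm0]
    simp only [← Finset.sum_sub_distrib, residualSS]
    exact Finset.sum_congr rfl fun k _ => Finset.sum_congr rfl fun j _ => by ring
  have hRSS : ∀ u : Fin p → ℝ, (∀ j ∉ A, u j = 0) → N * σ ≤ residualSS x R i u := by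
    intro u hu
    have h1 := hnormal (m - u) fun j hj => by simp [hm0 j hj, hu j hj]
    have h2 : residualSS x R i u - residualSS x R i m =
        ∑ k ∈ R, ∑ j, ((m - u) ⬝ᵥ x k j) ^ 2 +
          2 * ∑ k ∈ R, ∑ j, ((m - u) ⬝ᵥ x k j) * (x k j i - m ⬝ᵥ x k j) := by
      simp only [residualSS, ← Finset.sum_sub_distrib, Finset.mul_sum, ← Finset.sum_add_distrib]
      refine Finset.sum_congr rfl fun k _ => Finset.sum_congr rfl fun j _ => ?_
      rw [sub_dotProduct]
      ring
    have h3 : 0 ≤ ∑ k ∈ R, ∑ j, ((m - u) ⬝ᵥ x k j) ^ 2 :=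
      Finset.sum_nonneg fun k _ => Finset.sum_nonneg fun j _ => sq_nonneg _
    rw [h1, hRSSm] at h2
    linarith
  have hle : ∀ w', 0 < w' → nodeLoss x R i l w ≤ nodeLoss x R i m w' := by
    intro w' hw'
    by_cases heq : (m, w') = (l, w)
    · rw [Prod.mk.injEq] at heq
      rw [heq.1, heq.2]
    · exact (h.2 m w' hm0 hw' heq).le
  have hw := h.1.2
  have hσ0 : 0 ≤ σ := by
    have : 0 ≤ N * σ := hRSSm ▸
      Finset.sum_nonneg fun k _ => Finset.sum_nonneg fun j _ => sq_nonneg _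
    exact nonneg_of_mul_nonneg_right this hN
  have hσpos : 0 < σ := by
    refine lt_of_le_of_ne hσ0 fun h0 => ?_
    have hRSS0 : residualSS x R i m = 0 := by rw [hRSSm, ← h0, mul_zero]
    -- With zero residuals, the smaller variance `w / e` would lower the logarithmic term by `N /
    -- 2`, contradicting minimality.
    have h1 := hle (w * Real.exp (-1)) (mul_pos hw (Real.exp_pos _))
    rw [nodeLoss_eq, nodeLoss_eq, hRSS0, zero_div,
      Real.log_mul hw.ne' (Real.exp_pos _).ne', Real.log_exp] at h1
    have h2 : 0 ≤ residualSS x R i l / (2 * w) :=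
      div_nonneg (Finset.sum_nonneg fun k _ => Finset.sum_nonneg fun j _ => sq_nonneg _)
        (by linarith)
    rw [← hNdef] at h1
    linarith
  have hvalue : nodeLoss x R i l w = N / 2 * (Real.log σ + 1) := by
    apply le_antisymm
    · refine (hle σ hσpos).trans_eq ?_
      rw [nodeLoss_eq, hRSSm]
      rw [← hNdef]
      field_simp
    · rw [nodeLoss_eq, ← hNdef]
      have h1 : N * σ / (2 * w) ≤ residualSS x R i l / (2 * w) :=
        div_le_div_of_nonneg_right (hRSS l h.1.1) (by linarith)
      -- The inequality `1 + t ≤ e^t` at `t = log (σ / w)` shows that `w = σ` is the best variance.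
      have h2 := Real.add_one_le_exp (Real.log σ - Real.log w)
      rw [Real.exp_sub, Real.exp_log hσpos, Real.exp_log hw] at h2
      have h3 : N / 2 * (Real.log σ - Real.log w + 1) ≤ N / 2 * (σ / w) :=
        mul_le_mul_of_nonneg_left h2 (by linarith)
      have h4 : N * σ / (2 * w) = N / 2 * (σ / w) := by field_simp
      linarith
  have hins : (subMat S (insert i A)).det = (subMat S A).det * σ := det_subMat_insert S A hi hdet
  rw [hvalue, sum_dataTerm x hN.ne' A hdet, sum_dataTerm x hN.ne' (insert i A)
    (by rw [← hS, hins]; exact mul_ne_zero hdet hσpos.ne'), ← hS, hins,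
    Real.log_mul hdet hσpos.ne', Finset.card_insert_of_notMem hi, ← hNdef, Nat.cast_succ]
  ring

end NodeMin

/-! ### Parents in the `I`-DAG and the parameter count -/

/-- The experiments that intervene on the node `i`. -/
noncomputable def targeting {p K : ℕ} (I : Fin (K + 1) → Finset (Fin p)) (i : Fin p) :
    Finset (Fin (K + 1)) :=
  Finset.univ.filter fun k => i ∈ I k

theorem mem_targeting {p K : ℕ} {I : Fin (K + 1) → Finset (Fin p)} {i : Fin p}
    {k : Fin (K + 1)} : k ∈ targeting I i ↔ i ∈ I k := by
  simp [targeting]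

theorem zero_notMem_targeting {p K : ℕ} {I : Fin (K + 1) → Finset (Fin p)} (hI : I 0 = ∅)
    (i : Fin p) : 0 ∉ targeting I i := by
  simp [mem_targeting, hI]

theorem DAG.mem_pa {V : Type} [Fintype V] (G : DAG V) {i j : V} : j ∈ G.pa i ↔ G.Adj j i := by
  simp [DAG.pa]

theorem iDAG_pa_inr {p K : ℕ} (G : DAG (Fin p)) (I : Fin (K + 1) → Finset (Fin p))
    (k : Fin K) : (iDAG G I).pa (Sum.inr k) = ∅ := by
  ext (a | a) <;> simp [DAG.pa, iDAG, iDAGAdj]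

theorem iDAG_pa_inl_toLeft {p K : ℕ} (G : DAG (Fin p)) (I : Fin (K + 1) → Finset (Fin p))
    (i : Fin p) : ((iDAG G I).pa (Sum.inl i)).toLeft = G.pa i := by
  ext a
  rw [Finset.mem_toLeft, DAG.mem_pa, DAG.mem_pa]
  rfl

theorem iDAG_pa_inl_toRight {p K : ℕ} (G : DAG (Fin p)) {I : Fin (K + 1) → Finset (Fin p)}
    (hI : I 0 = ∅) (i : Fin p) :
    ((iDAG G I).pa (Sum.inl i)).toRight.map (Fin.succEmb K) = targeting I i := by
  ext k
  refine Fin.cases ?_ (fun k => ?_) k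
  · simp [zero_notMem_targeting hI]
  · rw [← Fin.coe_succEmb, Finset.mem_map', Finset.mem_toRight, DAG.mem_pa, mem_targeting]
    rfl

theorem iDAG_fa_inl_toLeft {p K : ℕ} (G : DAG (Fin p)) (I : Fin (K + 1) → Finset (Fin p))
    (i : Fin p) : ((iDAG G I).fa (Sum.inl i)).toLeft = insert i (G.pa i) := by
  ext a
  rw [Finset.mem_insert, ← iDAG_pa_inl_toLeft G I i, Finset.mem_toLeft, Finset.mem_toLeft]
  simp [DAG.fa]

theorem iDAG_fa_inl_toRight {p K : ℕ} (G : DAG (Fin p)) (I : Fin (K + 1) → Finset (Fin p))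
    (i : Fin p) : ((iDAG G I).fa (Sum.inl i)).toRight = ((iDAG G I).pa (Sum.inl i)).toRight := by
  ext k
  simp [DAG.fa]

theorem DAG.notMem_pa {V : Type} [Fintype V] (G : DAG V) (i : V) : i ∉ G.pa i := by
  rw [G.mem_pa]
  exact fun h => G.acyclic i (Relation.TransGen.single h)

theorem DAG.numEdges_eq_sum {V : Type} [Fintype V] (G : DAG V) :
    G.numEdges = ∑ i, (G.pa i).card := by
  simp only [DAG.numEdges, DAG.pa, Finset.card_filter]
  rw [Fintype.sum_prod_type, Finset.sum_comm]

/-- Double counting of the pairs `(k, i)` with `i ∈ I_k` rewrites the penalty as a sum over nodes;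
`k = 0` adds nothing since `I_0` is empty. -/
theorem numFreeParams_eq {p K : ℕ} (G : DAG (Fin p)) {I : Fin (K + 1) → Finset (Fin p)}
    (hI : I 0 = ∅) :
    numFreeParams G I = p + ∑ k : Fin K, (I k.succ).card +
      ∑ i, (1 + (targeting I i).card) * (G.pa i).card := by
  have h : ∑ i, (targeting I i).card * (G.pa i).card =
      ∑ k : Fin K, ∑ i ∈ I k.succ, (G.pa i).card := by
    simp only [targeting, Finset.card_filter, Finset.sum_mul, ite_mul, one_mul, zero_mul]
    rw [Finset.sum_comm, Fin.sum_univ_succ]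
    simp [hI]
  simp only [numFreeParams, add_mul, one_mul, Finset.sum_add_distrib, h, G.numEdges_eq_sum]
  ring

/-! ### The objective as BIC plus a constant -/

theorem IsMLE.sum_nodeLoss {p K : ℕ} {n : Fin (K + 1) → ℕ} {I : Fin (K + 1) → Finset (Fin p)}
    (hI : I 0 = ∅) {x : Dataset p K n} {G : DAG (Fin p)} {θ : GaussParams p K}
    (hθ : IsMLE I x G θ) (i : Fin p) :
    ∑ k, nodeLoss x {k} i ((θ k).1 i) ((θ k).2 i) =
      alphaCoord x (G.pa i) (targeting I i) - alphaCoord x (insert i (G.pa i)) (targeting I i) -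
        Real.log (totalSize n) / 2 * ((1 + (targeting I i).card) * (G.pa i).card) := by
  set Z := targeting I i with hZ
  have h0 : (0 : Fin (K + 1)) ∈ Zᶜ := by
    simpa using zero_notMem_targeting hI i
  have hobs : ∀ k ∈ Zᶜ, (θ k).1 i = (θ 0).1 i ∧ (θ k).2 i = (θ 0).2 i := by
    intro k hk
    have h := hθ.1.2.2 k i (by simpa [hZ, mem_targeting] using hk)
    exact ⟨funext h.1, h.2⟩
  have h1 : ∑ k ∈ Zᶜ, nodeLoss x {k} i ((θ k).1 i) ((θ k).2 i) =
      ∑ k ∈ Zᶜ, dataTerm x (insert i (G.pa i)) (pooledCov x Zᶜ) k -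
        ∑ k ∈ Zᶜ, dataTerm x (G.pa i) (pooledCov x Zᶜ) k := by
    rw [← (hθ.isNodeMin (R := Zᶜ) (fun k hk => iff_of_true (by simpa [hZ, mem_targeting] using hk)
      h0) h0 hobs).nodeLoss_eq_sum_dataTerm (G.notMem_pa i), nodeLoss_eq_sum]
    exact Finset.sum_congr rfl fun k hk => by rw [(hobs k hk).1, (hobs k hk).2]
  have h2 : ∑ k ∈ Z, nodeLoss x {k} i ((θ k).1 i) ((θ k).2 i) =
      ∑ k ∈ Z, dataTerm x (insert i (G.pa i)) (pooledCov x {k}) k -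
        ∑ k ∈ Z, dataTerm x (G.pa i) (pooledCov x {k}) k := by
    rw [← Finset.sum_sub_distrib]
    refine Finset.sum_congr rfl fun k hk => ?_
    have hik : i ∈ I k := mem_targeting.mp hk
    -- An experiment targeting `i` is a block of its own: it is neither `0` nor any experiment not
    -- targeting `i`.
    rw [(hθ.isNodeMin (R := {k}) (k₀ := k) (i := i) ?_ (by simp) ?_).nodeLoss_eq_sum_dataTerm
      (G.notMem_pa i), Finset.sum_singleton, Finset.sum_singleton]
    · intro k' hk'
      refine iff_of_false ?_ ?_ <;> rw [Finset.mem_singleton] <;> rintro rfl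
      · exact hk' hik
      · simp [hI] at hik
    · intro k' hk'
      rw [Finset.mem_singleton.mp hk']
      exact ⟨rfl, rfl⟩
  rw [← Finset.sum_compl_add_sum Z, h1, h2]
  -- The penalty per block comes from `C(a + 1, 2) - C(a, 2) = a` with `a` the number of parents.
  simp only [alphaCoord, Finset.sum_const, nsmul_eq_mul,
    Finset.card_insert_of_notMem (G.notMem_pa i), Nat.choose_succ_succ', Nat.choose_one_right]
  push_cast
  ring

/-- The part of the objective value at an `I`-DAG that depends on the data and the targets only,
beyond the BIC. -/
noncomputable def objectiveOffset {p K : ℕ} {n : Fin (K + 1) → ℕ}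
    (I : Fin (K + 1) → Finset (Fin p)) (x : Dataset p K n) : ℝ :=
  alphaVec x ∅ + ∑ k : Fin K, (alphaVec x {Sum.inr k} - alphaVec x ∅) +
    totalSize n * (p * Real.log (2 * Real.pi) / 2) +
    ((p + ∑ k : Fin K, (I k.succ).card : ℕ) : ℝ) * Real.log (totalSize n) / 2

theorem betaVec_dotProduct_charImset {p K : ℕ} {n : Fin (K + 1) → ℕ}
    {I : Fin (K + 1) → Finset (Fin p)} (hI : I 0 = ∅) {x : Dataset p K n} {G : DAG (Fin p)}
    {θ : GaussParams p K} (hθ : IsMLE I x G θ) :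
    betaVec x ⬝ᵥ (iDAG G I).charImset = BIC I x G θ + objectiveOffset I x := by
  have hnode : ∀ i, alphaVec x ((iDAG G I).fa (Sum.inl i)) -
      alphaVec x ((iDAG G I).pa (Sum.inl i)) =
        -∑ k, nodeLoss x {k} i ((θ k).1 i) ((θ k).2 i) -
          Real.log (totalSize n) / 2 * ((1 + (targeting I i).card) * (G.pa i).card) := by
    intro i
    rw [hθ.sum_nodeLoss hI, alphaVec, alphaVec, iDAG_fa_inl_toLeft, iDAG_fa_inl_toRight,
      iDAG_pa_inl_toLeft, iDAG_pa_inl_toRight G hI]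
    ring
  have hroot : ∀ k, alphaVec x ((iDAG G I).fa (Sum.inr k)) -
      alphaVec x ((iDAG G I).pa (Sum.inr k)) = alphaVec x {Sum.inr k} - alphaVec x ∅ := by
    intro k
    rw [DAG.fa, iDAG_pa_inr, insert_empty_eq]
  have hdot := (iDAG G I).moebius_dotProduct_charImset (alphaVec x)
  change betaVec x ⬝ᵥ (iDAG G I).charImset = _ at hdot
  rw [hdot, Fintype.sum_sum_type, Finset.sum_congr rfl fun i _ => hnode i,
    Finset.sum_congr rfl fun k _ => hroot k, Finset.sum_sub_distrib, Finset.sum_neg_distrib,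
    ← Finset.mul_sum, BIC, (log_likelihood x G I θ hθ.1).2, numFreeParams_eq G hI,
    objectiveOffset, Finset.sum_comm]
  push_cast
  ring

theorem mainTheorem8 {p K : ℕ} (I : Fin (K + 1) → Finset (Fin p)) (hI : I 0 = ∅)
    (n : Fin (K + 1) → ℕ) (x : Dataset p K n)
    (θ : DAG (Fin p) → GaussParams p K) (hθ : ∀ G, IsMLE I x G (θ G)) :
    -- the linear program is solved by the imset of some I-DAG
    (∃ G, IsLPSolution (betaVec x) (CIM I) (iDAG G I).charImset) ∧
    -- the I-DAGs whose imsets solve the linear program are exactly the BIC-optimal ones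
    (∀ G, IsLPSolution (betaVec x) (CIM I) (iDAG G I).charImset ↔ IsBICOptimal I x θ G) ∧
    -- every solution at a vertex is the imset of a BIC-optimal I-DAG
    (∀ y ∈ (CIM I).extremePoints ℝ, IsLPSolution (betaVec x) (CIM I) y →
      ∃ G, IsBICOptimal I x θ G ∧ y = (iDAG G I).charImset) ∧
    -- the set of all solutions is spanned by the BIC-optimal I-DAGs
    {y | IsLPSolution (betaVec x) (CIM I) y} =
      convexHull ℝ {y | ∃ G, IsBICOptimal I x θ G ∧ y = (iDAG G I).charImset} := by
  set c : DAG (Fin p) → Finset (Fin p ⊕ Fin K) → ℝ := fun G => (iDAG G I).charImset with hc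
  have hopt : ∀ G, (∀ H, betaVec x ⬝ᵥ c H ≤ betaVec x ⬝ᵥ c G) ↔ IsBICOptimal I x θ G := by
    intro G
    refine forall_congr' fun H => ?_
    rw [hc, betaVec_dotProduct_charImset hI (hθ H), betaVec_dotProduct_charImset hI (hθ G),
      add_le_add_iff_right]
  have hiff : ∀ G, IsLPSolution (betaVec x) (CIM I) (c G) ↔ IsBICOptimal I x θ G := fun G =>
    (isLPSolution_convexHull_iff (betaVec x) c G).trans (hopt G)
  have : Nonempty (DAG (Fin p)) := ⟨⟨⟨fun _ _ => False⟩, fun v h => by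
    obtain ⟨_, -, h'⟩ := Relation.TransGen.tail'_iff.mp h
    exact h'⟩⟩
  obtain ⟨G₀, hG₀⟩ := Finite.exists_max fun G => betaVec x ⬝ᵥ c G
  refine ⟨⟨G₀, (hiff G₀).mpr ((hopt G₀).mp hG₀)⟩, hiff, fun y hy hsol => ?_, ?_⟩
  -- An extreme point of a convex hull belongs to the generating set.
  · obtain ⟨G, rfl⟩ := extremePoints_convexHull_subset hy
    exact ⟨G, (hiff G).mp hsol, rfl⟩
  · simp_rw [← hopt]
    exact setOf_isLPSolution_convexHull (betaVec x) c G₀ hG₀
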